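/- Let $p\ge 2$, $\alpha=p-1$ and $\theta\ge 0$ be real numbers. For $\eta\ge 0$ put $\omega_\eta=\dfrac{2\pi^{(\eta+1)/2}}{\Gamma((\eta+1)/2)}$ and let $\mathrm d\lambda_\eta=\omega_\eta r^\eta\,\mathrm dr$ on $(0,\infty)$; write $\|f\|_{L^p_\eta}=\left(\int_0^\infty |f|^p\,\mathrm d\lambda_\eta\right)^{1/p}$. Let $\mu_{\alpha,\theta}=(\theta+1)\,\omega_\alpha^{1/\alpha}$ and $$\varphi_p(t)=e^t-\sum_{k=0}^{k_0-1}\frac{t^k}{k!},\qquad t\ge 0,\qquad k_0=\min\{j\in\mathbb N: j\ge p-1\}.$$ Let $X=X^{1,p}_\infty(\alpha,\theta)$ be the set of all locally absolutely continuous functions $u:(0,\infty)\to\mathbb R$ with $\lim_{r\to\infty}u(r)=0$, $u\in L^p_\theta$ and $u'\in L^p_\alpha$. For $0\le\mu\le\mu_{\alpha,\theta}$ define $$TMSC(\mu,\alpha,\theta)=\sup\left\{\frac{1}{\|u\|^p_{L^p_\theta}}\int_0^\infty\varphi_p\!\left(\mu|u|^{\frac p{p-1}}\right)\mathrm d\lambda_\theta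 \;:\; u\in X,\ u\neq 0,\ \|u'\|_{L^p_\alpha}\le 1\right\}\in[0,\infty].$$ Then there exist positive constants $c=c(\alpha,\theta)$ and $C=C(\alpha,\theta)$ such that, for all $\mu<\mu_{\alpha,\theta}$ close enough to $\mu_{\alpha,\theta}$ (how close depending only on $\alpha$ and $\theta$), $$\frac{c}{1-\left(\frac{\mu}{\mu_{\alpha,\theta}}\right)^{p-1}}\le TMSC(\mu,\alpha,\theta)\le\frac{C}{1-\left(\frac{\mu}{\mu_{\alpha,\theta}}\right)^{p-1}},$$ and the upper bound holds, with the same $C$, for every $0\le\mu<\mu_{\alpha,\theta}$. Moreover, $TMSC(\mu_{\alpha,\theta},\alpha,\theta)=\infty$. -/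

import Mathlib

open MeasureTheory Set Filter Topology

noncomputable section

namespace TrudingerMoser

/-- The constant `ω_θ = 2 π^((θ+1)/2) / Γ((θ+1)/2)`. -/
def omega (θ : ℝ) : ℝ :=
  2 * Real.pi ^ ((θ + 1) / 2) / Real.Gamma ((θ + 1) / 2)

/-- The measure `dλ_θ = ω_θ r^θ dr` on the half-line `(0, ∞)`, as a measure on `ℝ`
which vanishes on `(-∞, 0]`. -/
def lam (θ : ℝ) : Measure ℝ :=
  (volume.restrict (Ioi (0 : ℝ))).withDensity
    (fun r => ENNReal.ofReal (omega θ * r ^ θ))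

/-- The critical constant `μ_{α,θ} = (θ+1) ω_α^(1/α)`. -/
def muCrit (α θ : ℝ) : ℝ := (θ + 1) * omega α ^ (1 / α)

/-- The truncated exponential `φ_p(t) = e^t - ∑_{k < k₀} t^k / k!`, where `k₀ = ⌈p - 1⌉` is the
least natural number `j` with `j ≥ p - 1`. -/
def phi (p t : ℝ) : ℝ :=
  Real.exp t - ∑ k ∈ Finset.range ⌈p - 1⌉₊, t ^ k / (k.factorial : ℝ)

/-- The weighted Sobolev space `X^{1,p}_∞(α,θ)`: the functions that are locally absolutely
continuous on `(0, ∞)` and tend to `0` at infinity, with `u ∈ L^p_θ` and `u' ∈ L^p_α`.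
The values of `u` on `(-∞, 0]` play no role. -/
structure MemX (p α θ : ℝ) (u : ℝ → ℝ) : Prop where
  locallyAC : ∀ a b : ℝ, 0 < a → a ≤ b → AbsolutelyContinuousOnInterval u a b
  tendsto_zero : Tendsto u atTop (𝓝 0)
  memLp : MemLp u (ENNReal.ofReal p) (lam θ)
  memLp_deriv : MemLp (deriv u) (ENNReal.ofReal p) (lam α)

/-- The supremum, in `[0, ∞]`, of `‖u‖^{-p}_{L^p_θ} ∫ φ_p(μ |u|^(p/(p-1))) dλ_θ` over all nonzero
`u` in `X^{1,p}_∞(α,θ)` with `‖u'‖_{L^p_α} ≤ 1`. -/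
def TMSC (p α θ μ : ℝ) : ENNReal :=
  ⨆ (u : ℝ → ℝ) (_ : MemX p α θ u) (_ : ∃ r : ℝ, 0 < r ∧ u r ≠ 0)
    (_ : eLpNorm (deriv u) (ENNReal.ofReal p) (lam α) ≤ 1),
    (∫⁻ r, ENNReal.ofReal (phi p (μ * |u r| ^ (p / (p - 1)))) ∂(lam θ)) /
      eLpNorm u (ENNReal.ofReal p) (lam θ) ^ p

end TrudingerMoser

end

/-!
The supremum is governed by Moser's one-dimensional inequality; no rearrangement is needed.

*Upper bound.* As `α = p - 1`, Hölder's inequality bounds the oscillation of `u` between `a` and `b`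
by its energy on `(a, b]` and the logarithmic length `log (b / a)` (`MemX.hasEnergy`). If `‖u'‖ ≤ 1`
and `N = ‖u‖^p`, put `q = (μ / μ_{α,θ})^(p-1)` and choose `ρ` with `ρ^(θ+1) = N / (1 - q)`.
Chebyshev's inequality gives a point `R ∈ (ρ, 2ρ)` with `|u R|^p ≤ C (1 - q)`
(`exists_mem_Ioo_abs_rpow_le`). On `(0, R)` the two-term Hölder inequality with weights `1 - q` and
`q` (`add_rpow_conj_le`) yields `μ |u|^(p/(p-1)) ≤ C + μ_{α,θ} |u - u R|^(p/(p-1))`, and the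
critical inequality of Moser bounds the integral by `C R^(θ+1)`, that is, by `C N / (1 - q)`
(`setLIntegral_Ioo_phi_le`). On `[R, ∞)` the function `u` is bounded by a constant, so that the
integrand is at most `C |u|^p` (`setLIntegral_Ici_phi_le`).

*Moser's inequality.* In logarithmic form it says that `∫ exp (-F) dr / r` over `(0, R)` is bounded,
where `F = log (R / r) - |ψ|^(p/(p-1)) ≥ 0` is the deficit of `ψ` in Hölder's inequality. A point of
small deficit far from `R` uses up almost all of the energy, so two such points are logarithmically
close (`log_gap_le`). Hence `{F ≤ l}` has logarithmic length `O(l)`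
(`exists_cover_deficit`), and summing over `l = n + 1` with weights `exp (-n)` proves the claim
(`lintegral_exp_deficit_le`).

*Lower bound.* Moser's functions `A * min L (log (1 / r))₊` have quotient at least
`c L exp (-(θ + 1) (1 - μ / μ_{α,θ}) L)` (`le_TMSC`). Taking `L = 1 / (1 - μ / μ_{α,θ})` gives the
rate below the critical constant, and `L → ∞` gives divergence at the critical constant.
-/

open MeasureTheory Set Filter Topology

namespace TrudingerMoser

/-! ### Moser's one-dimensional inequality -/

/-- Weighted two-term Hölder inequality. The weights `h` and `k` are the shares of the gradient
energy that are attributed to the two summands. -/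
lemma add_rpow_conj_le {p x y h k : ℝ} (hp : 1 < p) (hx : 0 ≤ x) (hy : 0 ≤ y) (hh : 0 < h)
    (hk : 0 < k) :
    (x + y) ^ (p / (p - 1)) ≤ (h + k) ^ (1 / (p - 1)) *
      (x ^ (p / (p - 1)) / h ^ (1 / (p - 1)) + y ^ (p / (p - 1)) / k ^ (1 / (p - 1))) := by
  have hp1 : 0 < p - 1 := by linarith
  have hq : p / (p - 1) = 1 + 1 / (p - 1) := by field_simp; ring
  have hq1 : 1 ≤ p / (p - 1) := by rw [hq]; linarith [one_div_pos.2 hp1]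
  have hhk : 0 < h + k := by positivity
  have hx' : x / h ∈ Ici (0 : ℝ) := div_nonneg hx hh.le
  have hy' : y / k ∈ Ici (0 : ℝ) := div_nonneg hy hk.le
  have hw : h / (h + k) + k / (h + k) = 1 := by field_simp
  have key := (convexOn_rpow hq1).2 hx' hy' (div_pos hh hhk).le (div_pos hk hhk).le hw
  simp only [smul_eq_mul] at key
  have e1 : h / (h + k) * (x / h) + k / (h + k) * (y / k) = (x + y) / (h + k) := by
    field_simp
  have e2 : ∀ {z w : ℝ}, 0 ≤ z → 0 < w →
      (z / w) ^ (p / (p - 1)) = z ^ (p / (p - 1)) / (w * w ^ (1 / (p - 1))) := by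
    intro z w hz hw
    rw [Real.div_rpow hz hw.le]
    congr 1
    rw [hq, Real.rpow_add hw, Real.rpow_one]
  rw [e1, e2 (by positivity) hhk, e2 hx hh, e2 hy hk, div_le_iff₀ (by positivity)] at key
  refine key.trans (le_of_eq ?_)
  have := Real.rpow_pos_of_pos hh (1 / (p - 1))
  have := Real.rpow_pos_of_pos hk (1 / (p - 1))
  field_simp

/-- The ratio between the logarithmic distance of two points and the deficit allowed at them. -/
noncomputable def gapConst (p : ℝ) : ℝ := (2 * p - 1) / (1 - (3 / 4 : ℝ) ^ (1 / (p - 1)))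

lemma three_fourths_rpow_lt_one {p : ℝ} (hp : 2 ≤ p) : (3 / 4 : ℝ) ^ (1 / (p - 1)) < 1 :=
  Real.rpow_lt_one (by norm_num) (by norm_num) (one_div_pos.2 (by linarith))

lemma gapConst_pos {p : ℝ} (hp : 2 ≤ p) : 0 < gapConst p :=
  div_pos (by linarith) (by linarith [three_fourths_rpow_lt_one hp])

/-- If the increment `x₁` is within `l` of being extremal for the logarithmic length `t`, then it
uses up almost all of the energy, so that `x₁ + x₂` can stay within `l` of being extremal only
along a further length `d` that is comparable to `l`. -/
lemma log_gap_le {p l t d x₁ x₂ g₁ g₂ : ℝ} (hp : 2 ≤ p) (hl : 0 < l)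
    (ht : 4 * (p - 1) * l ≤ t) (hd : 0 ≤ d) (hx₁ : 0 ≤ x₁) (hx₂ : 0 ≤ x₂) (hg₁ : 0 ≤ g₁)
    (hg₂ : 0 ≤ g₂) (hg : g₁ + g₂ ≤ 1)
    (h₁ : x₁ ^ (p / (p - 1)) ≤ g₁ ^ (1 / (p - 1)) * t)
    (h₂ : x₂ ^ (p / (p - 1)) ≤ g₂ ^ (1 / (p - 1)) * d)
    (h₃ : t - l ≤ x₁ ^ (p / (p - 1)))
    (h₄ : t + d - l ≤ (x₁ + x₂) ^ (p / (p - 1))) :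
    d ≤ gapConst p * l := by
  have hp1 : 1 ≤ p - 1 := by linarith
  have hp0 : 0 < p - 1 := by linarith
  have he : 0 < 1 / (p - 1) := one_div_pos.2 hp0
  have he1 : 1 / (p - 1) ≤ 1 := by rw [div_le_one hp0]; exact hp1
  have ht0 : 0 < t := lt_of_lt_of_le (by positivity) ht
  have hlt : l ≤ t := by nlinarith
  set δ := (p - 1) * l / t with hδ
  have hδ0 : 0 < δ := by positivity
  have hδ4 : δ ≤ 1 / 4 := by rw [hδ, div_le_iff₀ ht0]; linarith
  -- Bernoulli's inequality: the energy left over for `x₂` is at most `δ`.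
  have hg1 : 1 - δ ≤ g₁ := by
    have a1 : 1 - l / t ≤ g₁ ^ (1 / (p - 1)) := by
      have : (1 - l / t) * t ≤ g₁ ^ (1 / (p - 1)) * t := by
        have : (1 - l / t) * t = t - l := by field_simp
        linarith
      exact le_of_mul_le_mul_right this ht0
    have a0 : 0 ≤ 1 - l / t := by rw [sub_nonneg, div_le_one ht0]; exact hlt
    have a2 := Real.rpow_le_rpow a0 a1 hp0.le
    rw [← Real.rpow_mul hg₁, one_div_mul_cancel hp0.ne', Real.rpow_one] at a2
    have a3 := one_add_mul_self_le_rpow_one_add (s := -(l / t)) (by linarith) hp1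
    rw [← sub_eq_add_neg 1 (l / t)] at a3
    have : δ = (p - 1) * (l / t) := by rw [hδ, mul_div_assoc]
    linarith
  have hg2 : g₂ ≤ δ := by linarith
  have hH := add_rpow_conj_le (p := p) (by linarith) hx₁ hx₂ (h := 1 / 2) (k := δ) (by norm_num) hδ0
  have b1 : x₁ ^ (p / (p - 1)) ≤ t := by
    refine h₁.trans (mul_le_of_le_one_left ht0.le (Real.rpow_le_one hg₁ (by linarith) he.le))
  have hδe := Real.rpow_pos_of_pos hδ0 (1 / (p - 1))
  have b2 : x₂ ^ (p / (p - 1)) / δ ^ (1 / (p - 1)) ≤ d := by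
    rw [div_le_iff₀ hδe, mul_comm]
    exact h₂.trans (mul_le_mul_of_nonneg_right (Real.rpow_le_rpow hg₂ hg2 he.le) hd)
  have b3 : (1 / 2 + δ) ^ (1 / (p - 1)) * (x₁ ^ (p / (p - 1)) / (1 / 2) ^ (1 / (p - 1)))
      ≤ (1 + 2 * δ) * t := by
    have : (1 / 2 + δ) ^ (1 / (p - 1)) * (x₁ ^ (p / (p - 1)) / (1 / 2) ^ (1 / (p - 1)))
        = (1 + 2 * δ) ^ (1 / (p - 1)) * x₁ ^ (p / (p - 1)) := by
      rw [show (1 + 2 * δ) = (1 / 2 + δ) / (1 / 2) by ring,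
        Real.div_rpow (show 0 ≤ 1 / 2 + δ by positivity) (show (0 : ℝ) ≤ 1 / 2 by norm_num),
        mul_div_assoc', div_mul_eq_mul_div]
    rw [this]
    refine mul_le_mul ?_ b1 (by positivity) (by positivity)
    exact (Real.rpow_le_rpow_of_exponent_le (by linarith) he1).trans_eq (Real.rpow_one _)
  have b4 : (1 / 2 + δ) ^ (1 / (p - 1)) * (x₂ ^ (p / (p - 1)) / δ ^ (1 / (p - 1)))
      ≤ (3 / 4) ^ (1 / (p - 1)) * d :=
    mul_le_mul (Real.rpow_le_rpow (by positivity) (by linarith) he.le) b2 (by positivity)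
      (by positivity)
  rw [mul_add] at hH
  have hδt : δ * t = (p - 1) * l := by rw [hδ]; field_simp
  have h34 := three_fourths_rpow_lt_one hp
  rw [gapConst, div_mul_eq_mul_div, le_div_iff₀ (by linarith)]
  linarith

/-- The logarithmic length of an interval. -/
lemma setLIntegral_inv_Icc {a b : ℝ} (ha : 0 < a) (hab : a ≤ b) :
    ∫⁻ r in Icc a b, ENNReal.ofReal (1 / r) = ENNReal.ofReal (Real.log (b / a)) := by
  rw [← integral_inv_of_pos ha (ha.trans_le hab), intervalIntegral.integral_of_le hab,
    ← integral_Icc_eq_integral_Ioc, ofReal_integral_eq_lintegral_ofReal]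
  · simp
  · refine (ContinuousOn.integrableOn_Icc ?_)
    exact continuousOn_inv₀.mono fun x hx => (ha.trans_le hx.1).ne'
  · refine (ae_restrict_mem measurableSet_Icc).mono fun x hx => ?_
    exact inv_nonneg.2 (ha.trans_le hx.1).le

/-- The constant in Moser's inequality: the set where the deficit is below `n + 1` has logarithmic
length at most `(4 (p - 1) + 2 * gapConst p) (n + 1)` and contributes at most `exp (-n)` times its
length. -/
noncomputable def moserConst (p : ℝ) : ENNReal :=
  ∑' n : ℕ, ENNReal.ofReal (Real.exp (-n)) *
    ENNReal.ofReal ((4 * (p - 1) + 2 * gapConst p) * (n + 1))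

lemma moserConst_ne_top {p : ℝ} : moserConst p ≠ ⊤ := by
  have hs : Summable fun n : ℕ => Real.exp (-n) * ((4 * (p - 1) + 2 * gapConst p) * (n + 1)) := by
    have h1 := Real.summable_pow_mul_exp_neg_nat_mul 1 one_pos
    have h0 := Real.summable_pow_mul_exp_neg_nat_mul 0 one_pos
    refine ((h1.add h0).mul_left (4 * (p - 1) + 2 * gapConst p)).congr fun n => ?_
    simp
    ring
  unfold moserConst
  simp_rw [← ENNReal.ofReal_mul (Real.exp_pos _).le]
  exact hs.tsum_ofReal_ne_top

/-- A function with sub-extremal increments: the oscillation between `a` and `b` is controlled by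
the energy `κ` of `(a, b]` and the logarithmic length of `(a, b]`. -/
noncomputable def HasEnergy (p : ℝ) (κ : Measure ℝ) (ψ : ℝ → ℝ) : Prop :=
  ∀ a b : ℝ, 0 < a → a ≤ b →
    |ψ a - ψ b| ^ (p / (p - 1)) ≤ κ.real (Ioc a b) ^ (1 / (p - 1)) * Real.log (b / a)

lemma HasEnergy.rpow_le_log {p R r : ℝ} {κ : Measure ℝ} {ψ : ℝ → ℝ} (h : HasEnergy p κ ψ)
    (hp : 1 < p) (hκ : κ univ ≤ 1) (hr : 0 < r) (hrR : r ≤ R) :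
    |ψ r - ψ R| ^ (p / (p - 1)) ≤ Real.log (R / r) := by
  have hlog : 0 ≤ Real.log (R / r) := Real.log_nonneg ((one_le_div hr).2 hrR)
  have : κ.real (Ioc r R) ≤ 1 := ENNReal.toReal_le_of_le_ofReal zero_le_one
    (by simpa using (measure_mono (subset_univ _)).trans hκ)
  exact (h r R hr hrR).trans (mul_le_of_le_one_left hlog
    (Real.rpow_le_one measureReal_nonneg this (one_div_pos.2 (by linarith)).le))

/-- The points where the deficit `log (R / r) - |ψ r| ^ (p / (p - 1))` is at most `l` are covered
by two intervals of logarithmic length comparable to `l`. -/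
lemma exists_cover_deficit {p R l : ℝ} {κ : Measure ℝ} {ψ : ℝ → ℝ} (hp : 2 ≤ p) (hκ : κ univ ≤ 1)
    (hR : 0 < R) (hψR : ψ R = 0) (h : HasEnergy p κ ψ) (hl : 0 < l) :
    ∃ B : Set ℝ, MeasurableSet B ∧
      (∀ r ∈ Ioo 0 R, Real.log (R / r) - |ψ r| ^ (p / (p - 1)) ≤ l → r ∈ B) ∧
      ∫⁻ r in B, ENNReal.ofReal (1 / r) ≤
        ENNReal.ofReal ((4 * (p - 1) + 2 * gapConst p) * l) := by
  have hg := gapConst_pos hp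
  have hp1 : 0 < p - 1 := by linarith
  have hκt : ∀ s, κ s ≠ ⊤ := fun s =>
    ((measure_mono (subset_univ s)).trans hκ).trans_lt ENNReal.one_lt_top |>.ne
  set A := Icc (R * Real.exp (-(4 * (p - 1) * l))) R with hA
  have hAint : ∫⁻ r in A, ENNReal.ofReal (1 / r) = ENNReal.ofReal (4 * (p - 1) * l) := by
    rw [hA, setLIntegral_inv_Icc (by positivity)]
    · congr 1
      rw [show R / (R * Real.exp (-(4 * (p - 1) * l))) = Real.exp (4 * (p - 1) * l) by
        rw [Real.exp_neg]; field_simp]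
      exact Real.log_exp _
    · refine mul_le_of_le_one_right hR.le (Real.exp_le_one_iff.2 ?_)
      have : 0 ≤ 4 * (p - 1) * l := by positivity
      linarith
  have hmemA : ∀ r ∈ Ioo 0 R, Real.log (R / r) ≤ 4 * (p - 1) * l → r ∈ A := by
    intro r hr hlog
    refine ⟨?_, hr.2.le⟩
    rw [Real.log_le_iff_le_exp (div_pos hR hr.1), div_le_iff₀ hr.1] at hlog
    rw [Real.exp_neg, ← div_eq_mul_inv, div_le_iff₀ (Real.exp_pos _)]
    linarith
  -- Two points of small deficit that are far from `R` are at logarithmic distance `O(l)`.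
  have hgap : ∀ r s : ℝ, 0 < s → s ≤ r → r < R → 4 * (p - 1) * l ≤ Real.log (R / r) →
      Real.log (R / r) - |ψ r| ^ (p / (p - 1)) ≤ l →
      Real.log (R / s) - |ψ s| ^ (p / (p - 1)) ≤ l → Real.log (r / s) ≤ gapConst p * l := by
    intro r s hs hsr hrR hfar hr1 hs1
    have hr0 : 0 < r := hs.trans_le hsr
    have i1 := h r R hr0 hrR.le
    have i2 := h s r hs hsr
    rw [hψR, sub_zero] at i1
    have htri : |ψ s| ≤ |ψ r| + |ψ s - ψ r| := by
      have := abs_add_le (ψ r) (ψ s - ψ r)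
      rwa [add_sub_cancel] at this
    have hsum : κ.real (Ioc r R) + κ.real (Ioc s r) ≤ 1 := by
      rw [← measureReal_union _ measurableSet_Ioc (hκt _) (hκt _)]
      · exact ENNReal.toReal_le_of_le_ofReal zero_le_one
          (by simpa using (measure_mono (subset_univ _)).trans hκ)
      · rw [disjoint_comm]
        exact Ioc_disjoint_Ioc_of_le le_rfl
    refine log_gap_le hp hl hfar (Real.log_nonneg ((one_le_div hs).2 hsr)) (abs_nonneg _)
      (abs_nonneg _) measureReal_nonneg measureReal_nonneg hsum i1 i2 (by linarith) ?_
    have : Real.log (R / s) = Real.log (R / r) + Real.log (r / s) := by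
      rw [← Real.log_mul (div_pos hR hr0).ne' (div_pos hr0 hs).ne']
      congr 1
      field_simp
    have := Real.rpow_le_rpow (abs_nonneg _) htri (z := p / (p - 1)) (by positivity)
    linarith
  by_cases hex : ∃ r₀ ∈ Ioo 0 R, 4 * (p - 1) * l ≤ Real.log (R / r₀) ∧
      Real.log (R / r₀) - |ψ r₀| ^ (p / (p - 1)) ≤ l
  · obtain ⟨r₀, hr₀, hfar₀, hdef₀⟩ := hex
    have hr0 : 0 < r₀ := hr₀.1
    refine ⟨A ∪ Icc (r₀ * Real.exp (-(gapConst p * l))) (r₀ * Real.exp (gapConst p * l)),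
      measurableSet_Icc.union measurableSet_Icc, ?_, ?_⟩
    · intro r hr hdef
      rcases le_total (Real.log (R / r)) (4 * (p - 1) * l) with hc | hc
      · exact Or.inl (hmemA r hr hc)
      · right
        rcases le_total r r₀ with hrr | hrr
        · have := hgap r₀ r hr.1 hrr hr₀.2 hfar₀ hdef₀ hdef
          rw [Real.log_le_iff_le_exp (div_pos hr0 hr.1), div_le_iff₀ hr.1] at this
          constructor
          · rw [Real.exp_neg, ← div_eq_mul_inv, div_le_iff₀ (Real.exp_pos _)]
            linarith
          · exact hrr.trans (le_mul_of_one_le_right hr0.le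
              (Real.one_le_exp_iff.2 (by positivity)))
        · have := hgap r r₀ hr0 hrr hr.2 hc hdef hdef₀
          rw [Real.log_le_iff_le_exp (div_pos hr.1 hr0), div_le_iff₀ hr0] at this
          constructor
          · refine le_trans (mul_le_of_le_one_right hr0.le (Real.exp_le_one_iff.2 ?_)) hrr
            have : 0 ≤ gapConst p * l := by positivity
            linarith
          · linarith
    · refine (lintegral_union_le _ _ _).trans ?_
      rw [hAint, setLIntegral_inv_Icc (by positivity)]
      · rw [show r₀ * Real.exp (gapConst p * l) / (r₀ * Real.exp (-(gapConst p * l)))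
            = Real.exp (2 * gapConst p * l) by
          rw [mul_div_mul_left _ _ hr0.ne', ← Real.exp_sub]; ring_nf, Real.log_exp,
          ← ENNReal.ofReal_add (by positivity) (by positivity)]
        apply le_of_eq
        ring_nf
      · refine mul_le_mul_of_nonneg_left (Real.exp_le_exp.2 ?_) hr0.le
        have : 0 ≤ gapConst p * l := by positivity
        linarith
  · refine ⟨A, measurableSet_Icc, ?_, ?_⟩
    · intro r hr hdef
      refine hmemA r hr ?_
      by_contra! hc
      exact hex ⟨r, hr, hc.le, hdef⟩
    · rw [hAint]
      refine ENNReal.ofReal_le_ofReal ?_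
      have : 0 ≤ gapConst p * l := by positivity
      linarith

/-- Moser's inequality at the critical exponent, in logarithmic form. -/
lemma lintegral_exp_deficit_le {p R : ℝ} {κ : Measure ℝ} {ψ : ℝ → ℝ} (hp : 2 ≤ p)
    (hκ : κ univ ≤ 1) (hR : 0 < R) (hψR : ψ R = 0) (h : HasEnergy p κ ψ) :
    ∫⁻ r in Ioo 0 R, ENNReal.ofReal (Real.exp (|ψ r| ^ (p / (p - 1)) - Real.log (R / r)) / r)
      ≤ moserConst p := by
  have hcov := fun n : ℕ => exists_cover_deficit hp hκ hR hψR h (l := n + 1) (by positivity)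
  choose B hBm hB hBint using hcov
  have hp1 : 0 < p - 1 := by linarith
  have hdef : ∀ r ∈ Ioo 0 R, 0 ≤ Real.log (R / r) - |ψ r| ^ (p / (p - 1)) := by
    intro r hr
    have i1 := h.rpow_le_log (by linarith) hκ hr.1 hr.2.le
    rw [hψR, sub_zero] at i1
    linarith
  calc ∫⁻ r in Ioo 0 R, ENNReal.ofReal (Real.exp (|ψ r| ^ (p / (p - 1)) - Real.log (R / r)) / r)
      ≤ ∫⁻ r, ∑' n : ℕ, ENNReal.ofReal (Real.exp (-n)) *
          (B n).indicator (fun r => ENNReal.ofReal (1 / r)) r := by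
        rw [← lintegral_indicator measurableSet_Ioo]
        refine lintegral_mono fun r => ?_
        by_cases hr : r ∈ Ioo 0 R
        · rw [indicator_of_mem hr]
          set F := Real.log (R / r) - |ψ r| ^ (p / (p - 1)) with hF
          have hF0 := hdef r hr
          refine le_trans ?_ (ENNReal.le_tsum ⌊F⌋₊)
          rw [indicator_of_mem (hB _ r hr (Nat.lt_floor_add_one F).le),
            ← ENNReal.ofReal_mul (Real.exp_pos _).le, ← div_eq_mul_one_div]
          refine ENNReal.ofReal_le_ofReal (div_le_div_of_nonneg_right ?_ hr.1.le)
          refine Real.exp_le_exp.2 ?_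
          have := Nat.floor_le hF0
          linarith
        · rw [indicator_of_notMem hr]
          exact zero_le
    _ = ∑' n : ℕ, ENNReal.ofReal (Real.exp (-n)) * ∫⁻ r in B n, ENNReal.ofReal (1 / r) := by
        have hm : ∀ n, Measurable ((B n).indicator fun r : ℝ => ENNReal.ofReal (1 / r)) :=
          fun n => (by fun_prop : Measurable fun r : ℝ => ENNReal.ofReal (1 / r)).indicator (hBm n)
        rw [lintegral_tsum fun n => ((hm n).const_mul _).aemeasurable]
        refine tsum_congr fun n => ?_
        rw [lintegral_const_mul _ (hm n), lintegral_indicator (hBm n)]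
    _ ≤ moserConst p := by
        unfold moserConst
        gcongr with n
        exact hBint n

/-! ### The weighted measures, the truncated exponential and the radial estimates -/

lemma omega_pos {θ : ℝ} (hθ : 0 ≤ θ) : 0 < omega θ := by
  have := Real.Gamma_pos_of_pos (show 0 < (θ + 1) / 2 by linarith)
  have := Real.pi_pos
  unfold omega
  positivity

lemma muCrit_pos {α θ : ℝ} (hα : 0 ≤ α) (hθ : 0 ≤ θ) : 0 < muCrit α θ := by
  have := omega_pos hα
  unfold muCrit
  positivity

lemma setLIntegral_lam {θ : ℝ} {s : Set ℝ} (hs : MeasurableSet s) (hs0 : s ⊆ Ioi 0)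
    (f : ℝ → ENNReal) :
    ∫⁻ r in s, f r ∂(lam θ) = ∫⁻ r in s, ENNReal.ofReal (omega θ * r ^ θ) * f r := by
  unfold lam
  rw [setLIntegral_withDensity_eq_setLIntegral_mul_non_measurable _ (by fun_prop) _ hs
    (by simp), Measure.restrict_restrict hs, inter_eq_left.2 hs0]
  rfl

lemma lintegral_lam {θ : ℝ} (f : ℝ → ENNReal) :
    ∫⁻ r, f r ∂(lam θ) = ∫⁻ r in Ioi 0, f r ∂(lam θ) := by
  unfold lam
  rw [restrict_withDensity measurableSet_Ioi, Measure.restrict_restrict measurableSet_Ioi,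
    inter_self]

lemma eLpNorm_rpow_eq {p : ℝ} (hp : 0 < p) (ν : Measure ℝ) (f : ℝ → ℝ) :
    eLpNorm f (ENNReal.ofReal p) ν ^ p = ∫⁻ r, ‖f r‖ₑ ^ p ∂ν := by
  rw [eLpNorm_eq_lintegral_rpow_enorm_toReal (by simpa using hp) ENNReal.ofReal_ne_top,
    ENNReal.toReal_ofReal hp.le, ← ENNReal.rpow_mul, one_div_mul_cancel hp.ne', ENNReal.rpow_one]

lemma MemX.continuousOn {p α θ : ℝ} {u : ℝ → ℝ} (hu : MemX p α θ u) :
    ContinuousOn u (Ioi 0) := by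
  intro x hx
  have hx0 : 0 < x := hx
  have h := (hu.locallyAC (x / 2) (2 * x) (by positivity) (by linarith)).continuousOn
  rw [uIcc_of_le (by linarith)] at h
  exact (h.continuousAt (Icc_mem_nhds (by linarith) (by linarith))).continuousWithinAt

lemma MemX.eLpNorm_ne_zero {p α θ : ℝ} {u : ℝ → ℝ} (hu : MemX p α θ u) (hp : 0 < p) (hθ : 0 ≤ θ)
    (h0 : ∃ r : ℝ, 0 < r ∧ u r ≠ 0) : eLpNorm u (ENNReal.ofReal p) (lam θ) ≠ 0 := by
  obtain ⟨r, hr, hur⟩ := h0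
  intro h
  rw [eLpNorm_eq_zero_iff hu.memLp.1 (by simpa using hp)] at h
  have hac : volume.restrict (Ioi (0 : ℝ)) ≪ lam θ := by
    refine withDensity_absolutelyContinuous' (by fun_prop) ?_
    refine (ae_restrict_mem measurableSet_Ioi).mono fun x hx => ?_
    have := Real.rpow_pos_of_pos (mem_Ioi.1 hx) θ
    have := omega_pos hθ
    simp only [ne_eq, ENNReal.ofReal_eq_zero, not_le]
    positivity
  exact hur (Measure.eqOn_open_of_ae_eq (hac.ae_le h) isOpen_Ioi hu.continuousOn
    continuousOn_const (mem_Ioi.2 hr))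

/-- The energy measure `|u'|^p dλ_α`. -/
noncomputable def energy (p α : ℝ) (u : ℝ → ℝ) : Measure ℝ :=
  (lam α).withDensity fun r => ‖deriv u r‖ₑ ^ p

lemma energy_univ_le_one {p α : ℝ} {u : ℝ → ℝ} (hp : 0 < p)
    (h : eLpNorm (deriv u) (ENNReal.ofReal p) (lam α) ≤ 1) : energy p α u univ ≤ 1 := by
  rw [energy, withDensity_apply _ MeasurableSet.univ, Measure.restrict_univ,
    ← eLpNorm_rpow_eq hp]
  exact ENNReal.rpow_le_one h hp.le

/-- Since `α = p - 1`, Hölder's inequality bounds the oscillation of `u` in terms of its energy and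
of the logarithmic length of the interval. -/
lemma MemX.hasEnergy {p α θ : ℝ} {u : ℝ → ℝ} (hu : MemX p α θ u) (hp : 2 ≤ p) (hα : α = p - 1)
    (hE : energy p α u univ ≤ 1) (c : ℝ) :
    HasEnergy p (energy p α u) fun r => omega α ^ (1 / p) * (u r - c) := by
  intro a b ha hab
  have hp0 : 0 < p := by linarith
  have hp1 : 0 < p - 1 := by linarith
  have hω : 0 < omega α := omega_pos (by linarith)
  have hpq : p.HolderConjugate (p / (p - 1)) := Real.HolderConjugate.conjExponent (by linarith)
  have hκt : energy p α u (Ioc a b) ≠ ⊤ :=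
    ((measure_mono (subset_univ _)).trans hE).trans_lt ENNReal.one_lt_top |>.ne
  have hs0 : Ioc a b ⊆ Ioi 0 := fun x hx => ha.trans hx.1
  have hlog : 0 ≤ Real.log (b / a) := Real.log_nonneg ((one_le_div ha).2 hab)
  have hκ : energy p α u (Ioc a b)
      = ∫⁻ r in Ioc a b, ENNReal.ofReal (omega α * r ^ α) * ‖deriv u r‖ₑ ^ p := by
    rw [energy, withDensity_apply _ measurableSet_Ioc, setLIntegral_lam measurableSet_Ioc hs0]
  set W : ℝ → ℝ := fun r => omega α * r ^ α with hW
  have hWpos : ∀ r ∈ Ioc a b, 0 < W r := fun r hr =>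
    mul_pos hω (Real.rpow_pos_of_pos (hs0 hr) _)
  have hWm : Measurable W := by fun_prop
  have h1 : ENNReal.ofReal |u a - u b| ≤ ∫⁻ r in Ioc a b, ‖deriv u r‖ₑ := by
    have := (hu.locallyAC a b ha hab).integral_deriv_eq_sub
    rw [abs_sub_comm, ← this, intervalIntegral.integral_of_le hab, ← Real.norm_eq_abs,
      ofReal_norm]
    exact enorm_integral_le_lintegral_enorm _
  have h2 : ∫⁻ r in Ioc a b, ‖deriv u r‖ₑ = ∫⁻ r in Ioc a b,
      ((fun r => ‖deriv u r‖ₑ * ENNReal.ofReal (W r ^ (1 / p))) *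
        fun r => ENNReal.ofReal (W r ^ (-(1 / p)))) r := by
    refine setLIntegral_congr_fun measurableSet_Ioc fun r hr => ?_
    have := hWpos r hr
    simp only [Pi.mul_apply]
    rw [mul_assoc, ← ENNReal.ofReal_mul (by positivity), ← Real.rpow_add this, add_neg_cancel,
      Real.rpow_zero, ENNReal.ofReal_one, mul_one]
  have h3 := ENNReal.lintegral_mul_le_Lp_mul_Lq (volume.restrict (Ioc a b)) hpq
    (f := fun r => ‖deriv u r‖ₑ * ENNReal.ofReal (W r ^ (1 / p)))
    (g := fun r => ENNReal.ofReal (W r ^ (-(1 / p))))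
    (((measurable_deriv u).enorm.mul (hWm.pow_const _).ennreal_ofReal).aemeasurable)
    (hWm.pow_const _).ennreal_ofReal.aemeasurable
  have h4 : ∫⁻ r in Ioc a b, (‖deriv u r‖ₑ * ENNReal.ofReal (W r ^ (1 / p))) ^ p
      = energy p α u (Ioc a b) := by
    rw [hκ]
    refine setLIntegral_congr_fun measurableSet_Ioc fun r hr => ?_
    have := hWpos r hr
    rw [ENNReal.mul_rpow_of_nonneg _ _ hp0.le,
      ENNReal.ofReal_rpow_of_nonneg (by positivity) hp0.le, ← Real.rpow_mul this.le,
      one_div_mul_cancel hp0.ne', Real.rpow_one, mul_comm]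
  have h5 : ∫⁻ r in Ioc a b, ENNReal.ofReal (W r ^ (-(1 / p))) ^ (p / (p - 1))
      = ENNReal.ofReal (omega α ^ (-(1 / (p - 1))) * Real.log (b / a)) := by
    rw [ENNReal.ofReal_mul (by positivity), ← setLIntegral_inv_Icc ha hab,
      ← setLIntegral_congr (Ioc_ae_eq_Icc (α := ℝ) (μ := volume)),
      ← lintegral_const_mul _ (by fun_prop)]
    refine setLIntegral_congr_fun measurableSet_Ioc fun r hr => ?_
    have := hWpos r hr
    have hr0 : 0 < r := hs0 hr
    rw [ENNReal.ofReal_rpow_of_nonneg (by positivity) (by positivity), ← Real.rpow_mul this.le,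
      ← ENNReal.ofReal_mul (by positivity), show -(1 / p) * (p / (p - 1)) = -(1 / (p - 1)) by
        field_simp, hW]
    simp only
    rw [Real.mul_rpow hω.le (by positivity), ← Real.rpow_mul hr0.le, hα,
      show (p - 1) * -(1 / (p - 1)) = -1 by field_simp, Real.rpow_neg_one, one_div r]
  rw [h4, h5] at h3
  have h6 := (h1.trans_eq h2).trans h3
  have h7 := ENNReal.rpow_le_rpow h6 (z := p / (p - 1)) (by positivity)
  rw [ENNReal.mul_rpow_of_nonneg _ _ (by positivity), ← ENNReal.rpow_mul, ← ENNReal.rpow_mul,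
    one_div_mul_cancel (by positivity), ENNReal.rpow_one,
    show 1 / p * (p / (p - 1)) = 1 / (p - 1) by field_simp,
    ENNReal.ofReal_rpow_of_nonneg (abs_nonneg _) (by positivity)] at h7
  have h8 := ENNReal.toReal_mono (ENNReal.mul_ne_top
    (ENNReal.rpow_ne_top_of_nonneg (by positivity) hκt) ENNReal.ofReal_ne_top) h7
  rw [ENNReal.toReal_ofReal (by positivity), ENNReal.toReal_mul, ← ENNReal.toReal_rpow,
    ENNReal.toReal_ofReal (by positivity)] at h8
  have h9 : |omega α ^ (1 / p) * (u a - c) - omega α ^ (1 / p) * (u b - c)| ^ (p / (p - 1))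
      = omega α ^ (1 / (p - 1)) * |u a - u b| ^ (p / (p - 1)) := by
    rw [← mul_sub, sub_sub_sub_cancel_right, abs_mul, abs_of_pos (by positivity),
      Real.mul_rpow (by positivity) (abs_nonneg _), ← Real.rpow_mul hω.le]
    congr 2
    field_simp
  rw [h9]
  refine (mul_le_mul_of_nonneg_left h8 (Real.rpow_nonneg hω.le _)).trans_eq ?_
  have : omega α ^ (1 / (p - 1)) * omega α ^ (-(1 / (p - 1))) = 1 := by
    rw [← Real.rpow_add hω, add_neg_cancel, Real.rpow_zero]
  rw [Measure.real]
  linear_combination ((energy p α u (Ioc a b)).toReal ^ (1 / (p - 1)) * Real.log (b / a)) * this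

/-- Chebyshev's inequality: every dyadic interval contains a point at which `u` is not larger than
its `L^p_θ` norm allows. -/
lemma exists_mem_Ioo_abs_rpow_le {p θ N ρ : ℝ} {u : ℝ → ℝ} (hp : 0 < p) (hθ : 0 ≤ θ)
    (hN : 0 < N) (huN : ∫⁻ r, ‖u r‖ₑ ^ p ∂(lam θ) ≤ ENNReal.ofReal N) (hρ : 0 < ρ) :
    ∃ R ∈ Ioo ρ (2 * ρ), |u R| ^ p ≤ 2 * N / (omega θ * ρ ^ (θ + 1)) := by
  by_contra! hcon
  have hω := omega_pos hθ
  have hρ' := Real.rpow_pos_of_pos hρ θ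
  have hs0 : Ioo ρ (2 * ρ) ⊆ Ioi 0 := fun x hx => hρ.trans hx.1
  have : ENNReal.ofReal (2 * N) ≤ ENNReal.ofReal N := by
    calc ENNReal.ofReal (2 * N) = ∫⁻ r in Ioo ρ (2 * ρ), ENNReal.ofReal (2 * N / ρ) := by
          rw [setLIntegral_const, Real.volume_Ioo, ← ENNReal.ofReal_mul (by positivity)]
          congr 1
          field_simp
          ring
      _ ≤ ∫⁻ r in Ioo ρ (2 * ρ), ENNReal.ofReal (omega θ * r ^ θ) * ‖u r‖ₑ ^ p := by
          refine setLIntegral_mono' measurableSet_Ioo fun r hr => ?_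
          have hr0 : 0 < r := hs0 hr
          rw [← ofReal_norm, Real.norm_eq_abs, ENNReal.ofReal_rpow_of_nonneg (abs_nonneg _) hp.le,
            ← ENNReal.ofReal_mul (by positivity)]
          refine ENNReal.ofReal_le_ofReal ?_
          have e : 2 * N / ρ = omega θ * ρ ^ θ * (2 * N / (omega θ * ρ ^ (θ + 1))) := by
            rw [Real.rpow_add hρ, Real.rpow_one]
            field_simp
          rw [e]
          refine mul_le_mul ?_ (hcon r hr).le (by positivity) (by positivity)
          exact mul_le_mul_of_nonneg_left (Real.rpow_le_rpow hρ.le hr.1.le hθ) hω.le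
      _ = ∫⁻ r in Ioo ρ (2 * ρ), ‖u r‖ₑ ^ p ∂(lam θ) :=
          (setLIntegral_lam measurableSet_Ioo hs0 _).symm
      _ ≤ _ := (setLIntegral_le_lintegral _ _).trans huN
  rw [ENNReal.ofReal_le_ofReal_iff hN.le] at this
  linarith

lemma phi_le_exp {p t : ℝ} (ht : 0 ≤ t) : phi p t ≤ Real.exp t := by
  unfold phi
  have : 0 ≤ ∑ k ∈ Finset.range ⌈p - 1⌉₊, t ^ k / (k.factorial : ℝ) :=
    Finset.sum_nonneg fun k _ => by positivity
  linarith

lemma phi_le_pow_mul_exp {p t : ℝ} (ht : 0 ≤ t) : phi p t ≤ t ^ ⌈p - 1⌉₊ * Real.exp t := by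
  have h := Complex.norm_exp_sub_sum_le_norm_mul_exp (t : ℂ) ⌈p - 1⌉₊
  have e : Complex.exp (t : ℂ) - ∑ m ∈ Finset.range ⌈p - 1⌉₊, (t : ℂ) ^ m / (m.factorial : ℂ)
      = ((phi p t : ℝ) : ℂ) := by
    unfold phi
    push_cast
    rfl
  rw [e, Complex.norm_real, Complex.norm_real, Real.norm_eq_abs, Real.norm_eq_abs,
    abs_of_nonneg ht] at h
  exact (le_abs_self _).trans h

/-- On bounded sets `φ_p` is dominated by the power `p - 1`, because the truncation index is at
least `p - 1`. -/
lemma phi_mul_le_rpow {p μ m x M : ℝ} (hp : 1 < p) (hμ : 0 ≤ μ) (hμm : μ ≤ m) (hx : 0 ≤ x)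
    (hxM : x ≤ M) (hM : 0 < M) :
    phi p (μ * x) ≤
      m ^ ⌈p - 1⌉₊ * M ^ ((⌈p - 1⌉₊ : ℝ) - (p - 1)) * Real.exp (m * M) * x ^ (p - 1) := by
  have hc : p - 1 ≤ (⌈p - 1⌉₊ : ℝ) := Nat.le_ceil _
  have hm : 0 ≤ m := hμ.trans hμm
  refine (phi_le_pow_mul_exp (by positivity)).trans ?_
  have h1 : x ^ ⌈p - 1⌉₊ ≤ M ^ ((⌈p - 1⌉₊ : ℝ) - (p - 1)) * x ^ (p - 1) := by
    rcases hx.eq_or_lt with rfl | hx'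
    · have : ⌈p - 1⌉₊ ≠ 0 := by
        have : 0 < ⌈p - 1⌉₊ := Nat.ceil_pos.2 (by linarith)
        omega
      rw [zero_pow this]
      positivity
    · rw [← Real.rpow_natCast, show (⌈p - 1⌉₊ : ℝ) = ((⌈p - 1⌉₊ : ℝ) - (p - 1)) + (p - 1) by ring,
        Real.rpow_add hx']
      rw [sub_add_cancel]
      exact mul_le_mul_of_nonneg_right (Real.rpow_le_rpow hx hxM (by linarith)) (by positivity)
  have h2 : μ ^ ⌈p - 1⌉₊ ≤ m ^ ⌈p - 1⌉₊ := pow_le_pow_left₀ hμ hμm _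
  have h3 : Real.exp (μ * x) ≤ Real.exp (m * M) :=
    Real.exp_le_exp.2 (mul_le_mul hμm hxM hx hm)
  calc (μ * x) ^ ⌈p - 1⌉₊ * Real.exp (μ * x)
      = μ ^ ⌈p - 1⌉₊ * x ^ ⌈p - 1⌉₊ * Real.exp (μ * x) := by rw [mul_pow]
    _ ≤ m ^ ⌈p - 1⌉₊ * (M ^ ((⌈p - 1⌉₊ : ℝ) - (p - 1)) * x ^ (p - 1)) * Real.exp (m * M) := by
        gcongr
    _ = _ := by ring

/-! ### The upper bound -/

/-- The contribution of `(0, R)`. The energy share `1 - (μ / μ_{α,θ})^(p-1)` that is left over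
below the critical exponent pays for the boundary value `u R`; the oscillation `u - u R` is
then estimated by Moser's inequality at the critical exponent. -/
lemma setLIntegral_Ioo_phi_le {p α θ μ R : ℝ} {u : ℝ → ℝ} (hu : MemX p α θ u) (hp : 2 ≤ p)
    (hα : α = p - 1) (hθ : 0 ≤ θ) (hE : energy p α u univ ≤ 1) (hμ0 : 0 < μ)
    (hμ : μ < muCrit α θ) (hR : 0 < R)
    (huR : |u R| ^ p ≤ 2 * (1 - (μ / muCrit α θ) ^ (p - 1)) / omega θ) :
    ∫⁻ r in Ioo 0 R, ENNReal.ofReal (phi p (μ * |u r| ^ (p / (p - 1)))) ∂(lam θ) ≤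
      ENNReal.ofReal (omega θ * Real.exp (muCrit α θ * (2 / omega θ) ^ (1 / (p - 1)))
        * R ^ (θ + 1)) * moserConst p := by
  have hp0 : 0 < p := by linarith
  have hp1 : 0 < p - 1 := by linarith
  have hωα : 0 < omega α := omega_pos (by linarith)
  have hωθ : 0 < omega θ := omega_pos hθ
  have hμs : 0 < muCrit α θ := muCrit_pos (by linarith) hθ
  set m := muCrit α θ with hm
  set q := (μ / m) ^ (p - 1) with hq
  have hq0 : 0 < q := by positivity
  have hq1 : 0 < 1 - q := by
    have : q < 1 := Real.rpow_lt_one (by positivity) ((div_lt_one hμs).2 hμ) hp1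
    linarith
  have hqe : q ^ (1 / (p - 1)) = μ / m := by
    rw [hq, ← Real.rpow_mul (by positivity), mul_one_div_cancel hp1.ne', Real.rpow_one]
  set ψ : ℝ → ℝ := fun r => omega α ^ (1 / p) * (u r - u R) with hψ
  have hψR : ψ R = 0 := by simp [hψ]
  have hH : HasEnergy p (energy p α u) ψ := hu.hasEnergy hp hα hE (u R)
  have hψe : ∀ r, m * |u r - u R| ^ (p / (p - 1)) = (θ + 1) * |ψ r| ^ (p / (p - 1)) := by
    intro r
    simp only [hψ]
    rw [hm, muCrit, abs_mul, abs_of_pos (Real.rpow_pos_of_pos hωα _),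
      Real.mul_rpow (by positivity) (abs_nonneg _), ← Real.rpow_mul hωα.le,
      show 1 / p * (p / (p - 1)) = 1 / α by rw [hα]; field_simp]
    ring
  have hpt : ∀ r, μ * |u r| ^ (p / (p - 1)) ≤
      m * (2 / omega θ) ^ (1 / (p - 1)) + (θ + 1) * |ψ r| ^ (p / (p - 1)) := by
    intro r
    have htri : |u r| ≤ |u R| + |u r - u R| := by
      have := abs_add_le (u R) (u r - u R)
      rwa [add_sub_cancel] at this
    have h1 := (Real.rpow_le_rpow (abs_nonneg _) htri (z := p / (p - 1)) (by positivity)).trans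
      (add_rpow_conj_le (by linarith) (abs_nonneg (u R)) (abs_nonneg (u r - u R)) hq1 hq0)
    rw [sub_add_cancel, Real.one_rpow, one_mul, hqe] at h1
    have h2 : |u R| ^ (p / (p - 1)) / (1 - q) ^ (1 / (p - 1)) ≤ (2 / omega θ) ^ (1 / (p - 1)) := by
      rw [div_le_iff₀ (Real.rpow_pos_of_pos hq1 _), ← Real.mul_rpow (by positivity) hq1.le,
        show p / (p - 1) = p * (1 / (p - 1)) by ring, Real.rpow_mul (abs_nonneg _)]
      refine Real.rpow_le_rpow (by positivity) (huR.trans_eq ?_) (by positivity)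
      ring
    calc μ * |u r| ^ (p / (p - 1))
        ≤ μ * ((2 / omega θ) ^ (1 / (p - 1)) + |u r - u R| ^ (p / (p - 1)) / (μ / m)) := by
          refine mul_le_mul_of_nonneg_left (h1.trans ?_) hμ0.le
          linarith
      _ = μ * (2 / omega θ) ^ (1 / (p - 1)) + m * |u r - u R| ^ (p / (p - 1)) := by
          field_simp
      _ ≤ _ := by
          rw [hψe]
          have : 0 ≤ (2 / omega θ) ^ (1 / (p - 1)) := by positivity
          nlinarith
  have hMoser := lintegral_exp_deficit_le hp hE hR hψR hH
  rw [setLIntegral_lam measurableSet_Ioo fun r hr => hr.1]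
  refine le_trans ?_ (mul_le_mul_right hMoser _)
  rw [← lintegral_const_mul' _ _ ENNReal.ofReal_ne_top]
  refine setLIntegral_mono' measurableSet_Ioo fun r hr => ?_
  have hr0 : 0 < r := hr.1
  have hrθ : 0 < r ^ θ := Real.rpow_pos_of_pos hr0 θ
  rw [← ENNReal.ofReal_mul (by positivity), ← ENNReal.ofReal_mul (by positivity)]
  refine ENNReal.ofReal_le_ofReal ?_
  set D := |ψ r| ^ (p / (p - 1)) - Real.log (R / r) with hD
  have hD0 : D ≤ 0 := by
    have := hH.rpow_le_log (by linarith) hE hr0 hr.2.le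
    rw [hψR, sub_zero] at this
    linarith
  have h3 : phi p (μ * |u r| ^ (p / (p - 1))) ≤
      Real.exp (m * (2 / omega θ) ^ (1 / (p - 1))) * (Real.exp D * (R / r) ^ (θ + 1)) := by
    refine (phi_le_exp (by positivity)).trans ?_
    rw [Real.rpow_def_of_pos (div_pos hR hr0), ← Real.exp_add, ← Real.exp_add]
    refine Real.exp_le_exp.2 ((hpt r).trans ?_)
    have : |ψ r| ^ (p / (p - 1)) = D + Real.log (R / r) := by rw [hD]; ring
    rw [this]
    nlinarith
  calc omega θ * r ^ θ * phi p (μ * |u r| ^ (p / (p - 1)))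
      ≤ omega θ * r ^ θ *
        (Real.exp (m * (2 / omega θ) ^ (1 / (p - 1))) * (Real.exp D * (R / r) ^ (θ + 1))) :=
        mul_le_mul_of_nonneg_left h3 (by positivity)
    _ = _ := by
        rw [Real.div_rpow hR.le hr0.le, Real.rpow_add hr0, Real.rpow_one]
        field_simp

/-- A bound for the functions of energy at most one on the half-line `[ρ, ∞)`, where `ρ ^ (θ + 1)`
dominates their `L^p_θ` norm. -/
noncomputable def tailBound (p α θ : ℝ) : ℝ :=
  (2 / omega θ) ^ (1 / p) + (omega α ^ (1 / p))⁻¹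

lemma tailBound_pos {p α θ : ℝ} (hα : 0 ≤ α) (hθ : 0 ≤ θ) : 0 < tailBound p α θ := by
  have := omega_pos hα
  have := omega_pos hθ
  unfold tailBound
  positivity

lemma MemX.abs_le_tailBound {p α θ N ρ r : ℝ} {u : ℝ → ℝ} (hu : MemX p α θ u) (hp : 2 ≤ p)
    (hα : α = p - 1) (hθ : 0 ≤ θ) (hE : energy p α u univ ≤ 1) (hN : 0 < N)
    (huN : ∫⁻ r, ‖u r‖ₑ ^ p ∂(lam θ) ≤ ENNReal.ofReal N) (hρ : 0 < ρ) (hNρ : N ≤ ρ ^ (θ + 1))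
    (hr : ρ ≤ r) : |u r| ≤ tailBound p α θ := by
  have hp0 : 0 < p := by linarith
  have hp1 : 0 < p - 1 := by linarith
  have hωα : 0 < omega α := omega_pos (by linarith)
  have hωθ : 0 < omega θ := omega_pos hθ
  have hr0 : 0 < r := hρ.trans_le hr
  obtain ⟨R, hR, huR⟩ := exists_mem_Ioo_abs_rpow_le hp0 hθ hN huN hr0
  have h1 : |u R| ≤ (2 / omega θ) ^ (1 / p) := by
    have : |u R| ^ p ≤ 2 / omega θ := by
      refine huR.trans ?_
      rw [div_le_div_iff₀ (by positivity) hωθ]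
      have := hNρ.trans (Real.rpow_le_rpow hρ.le hr (by linarith : 0 ≤ θ + 1))
      nlinarith
    have := Real.rpow_le_rpow (by positivity) this (z := 1 / p) (by positivity)
    rwa [← Real.rpow_mul (abs_nonneg _), mul_one_div_cancel hp0.ne', Real.rpow_one] at this
  have h2 : |u r - u R| ≤ (omega α ^ (1 / p))⁻¹ := by
    have h := (hu.hasEnergy hp hα hE 0).rpow_le_log (by linarith) hE hr0 hR.1.le
    simp only [sub_zero] at h
    have hlog : Real.log (R / r) ≤ 1 := by
      have h2 : R / r ≤ 2 := by rw [div_le_iff₀ hr0]; exact hR.2.le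
      have := Real.log_le_log (div_pos (hr0.trans hR.1) hr0) h2
      linarith [Real.log_two_lt_d9]
    have h3 : |omega α ^ (1 / p) * u r - omega α ^ (1 / p) * u R| ≤ 1 := by
      by_contra! hc
      have := Real.one_lt_rpow hc (z := p / (p - 1)) (by positivity)
      linarith
    rw [← mul_sub, abs_mul, abs_of_pos (by positivity)] at h3
    rwa [← one_div, le_div_iff₀' (by positivity)]
  have := abs_add_le (u R) (u r - u R)
  rw [add_sub_cancel] at this
  exact this.trans (add_le_add h1 h2)

/-- The constant that compares `φ_p(μ |u|^(p/(p-1)))` with `|u|^p` for `|u| ≤ tailBound p α θ`. -/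
noncomputable def tailConst (p α θ : ℝ) : ℝ :=
  muCrit α θ ^ ⌈p - 1⌉₊ *
    (tailBound p α θ ^ (p / (p - 1))) ^ ((⌈p - 1⌉₊ : ℝ) - (p - 1)) *
    Real.exp (muCrit α θ * tailBound p α θ ^ (p / (p - 1)))

lemma tailConst_pos {p α θ : ℝ} (hα : 0 ≤ α) (hθ : 0 ≤ θ) : 0 < tailConst p α θ := by
  have := muCrit_pos hα hθ
  have := tailBound_pos (p := p) hα hθ
  unfold tailConst
  positivity

lemma setLIntegral_Ici_phi_le {p α θ μ N ρ : ℝ} {u : ℝ → ℝ} (hu : MemX p α θ u) (hp : 2 ≤ p)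
    (hα : α = p - 1) (hθ : 0 ≤ θ) (hE : energy p α u univ ≤ 1) (hμ0 : 0 ≤ μ)
    (hμ : μ ≤ muCrit α θ) (hN : 0 < N)
    (huN : ∫⁻ r, ‖u r‖ₑ ^ p ∂(lam θ) ≤ ENNReal.ofReal N) (hρ : 0 < ρ)
    (hNρ : N ≤ ρ ^ (θ + 1)) :
    ∫⁻ r in Ici ρ, ENNReal.ofReal (phi p (μ * |u r| ^ (p / (p - 1)))) ∂(lam θ) ≤
      ENNReal.ofReal (tailConst p α θ * N) := by
  have hp0 : 0 < p := by linarith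
  have hp1 : 0 < p - 1 := by linarith
  have hα0 : 0 ≤ α := by linarith
  have hT := tailConst_pos (p := p) hα0 hθ
  calc ∫⁻ r in Ici ρ, ENNReal.ofReal (phi p (μ * |u r| ^ (p / (p - 1)))) ∂(lam θ)
      ≤ ∫⁻ r in Ici ρ, ENNReal.ofReal (tailConst p α θ) * ‖u r‖ₑ ^ p ∂(lam θ) := by
        refine setLIntegral_mono' measurableSet_Ici fun r hr => ?_
        have hb := hu.abs_le_tailBound hp hα hθ hE hN huN hρ hNρ hr
        rw [← ofReal_norm, Real.norm_eq_abs, ENNReal.ofReal_rpow_of_nonneg (abs_nonneg _) hp0.le,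
          ← ENNReal.ofReal_mul hT.le]
        refine ENNReal.ofReal_le_ofReal ?_
        have := phi_mul_le_rpow (p := p) (by linarith) hμ0 hμ
          (Real.rpow_nonneg (abs_nonneg (u r)) (p / (p - 1)))
          (Real.rpow_le_rpow (abs_nonneg _) hb (by positivity))
          (Real.rpow_pos_of_pos (tailBound_pos hα0 hθ) _)
        rwa [← Real.rpow_mul (abs_nonneg _), div_mul_cancel₀ _ hp1.ne'] at this
    _ = ENNReal.ofReal (tailConst p α θ) * ∫⁻ r in Ici ρ, ‖u r‖ₑ ^ p ∂(lam θ) :=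
        lintegral_const_mul' _ _ ENNReal.ofReal_ne_top
    _ ≤ ENNReal.ofReal (tailConst p α θ) * ENNReal.ofReal N :=
        mul_le_mul_right ((setLIntegral_le_lintegral _ _).trans huN) _
    _ = _ := (ENNReal.ofReal_mul hT.le).symm

/-- The constant of the upper bound: the first summand comes from the interval `(0, R)`, the second
one from its complement. -/
noncomputable def upperConst (p α θ : ℝ) : ℝ :=
  omega θ * Real.exp (muCrit α θ * (2 / omega θ) ^ (1 / (p - 1))) * 2 ^ (θ + 1) *
    (moserConst p).toReal + tailConst p α θ

lemma upperConst_pos {p α θ : ℝ} (hα : 0 ≤ α) (hθ : 0 ≤ θ) : 0 < upperConst p α θ := by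
  have := omega_pos hθ
  have := tailConst_pos (p := p) hα hθ
  unfold upperConst
  positivity

/-- The upper bound for a single function, in terms of `N = ‖u‖^p`. The half-line is cut near the
radius `ρ` with `ρ ^ (θ + 1) = N / (1 - (μ / μ_{α,θ})^(p-1))`. -/
lemma lintegral_phi_le {p α θ μ N : ℝ} {u : ℝ → ℝ} (hu : MemX p α θ u) (hp : 2 ≤ p)
    (hα : α = p - 1) (hθ : 0 ≤ θ) (hE : energy p α u univ ≤ 1) (hμ0 : 0 ≤ μ)
    (hμ : μ < muCrit α θ) (hN : 0 < N)
    (huN : ∫⁻ r, ‖u r‖ₑ ^ p ∂(lam θ) ≤ ENNReal.ofReal N) :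
    ∫⁻ r, ENNReal.ofReal (phi p (μ * |u r| ^ (p / (p - 1)))) ∂(lam θ) ≤
      ENNReal.ofReal (upperConst p α θ / (1 - (μ / muCrit α θ) ^ (p - 1)) * N) := by
  have hp0 : 0 < p := by linarith
  have hp1 : 0 < p - 1 := by linarith
  have hα0 : 0 ≤ α := by linarith
  have hωθ : 0 < omega θ := omega_pos hθ
  have hμs : 0 < muCrit α θ := muCrit_pos hα0 hθ
  rcases hμ0.eq_or_lt with rfl | hμ0'
  · have : phi p 0 = 0 := by
      unfold phi
      obtain ⟨n, hn⟩ := Nat.exists_eq_succ_of_ne_zero (Nat.ceil_pos.2 hp1).ne'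
      rw [hn, Finset.sum_range_succ']
      simp
    simp [this]
  set q := (μ / muCrit α θ) ^ (p - 1) with hq
  have hq0 : 0 < q := by positivity
  have hσ : 0 < 1 - q := by
    have : q < 1 := Real.rpow_lt_one (by positivity) ((div_lt_one hμs).2 hμ) hp1
    linarith
  set ρ := (N / (1 - q)) ^ (1 / (θ + 1)) with hρdef
  have hρ : 0 < ρ := by positivity
  have hρθ : ρ ^ (θ + 1) = N / (1 - q) := by
    rw [hρdef, ← Real.rpow_mul (by positivity), one_div_mul_cancel (by positivity), Real.rpow_one]
  obtain ⟨R, hR, huR⟩ := exists_mem_Ioo_abs_rpow_le hp0 hθ hN huN hρ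
  have hR0 : 0 < R := hρ.trans hR.1
  have hNρ : N ≤ ρ ^ (θ + 1) := by
    rw [hρθ, le_div_iff₀ hσ]
    nlinarith
  have huR' : |u R| ^ p ≤ 2 * (1 - q) / omega θ := by
    refine huR.trans_eq ?_
    rw [hρθ]
    field_simp
  have hin := setLIntegral_Ioo_phi_le hu hp hα hθ hE hμ0' hμ hR0 huR'
  have hout := setLIntegral_Ici_phi_le hu hp hα hθ hE hμ0 hμ.le hN huN hR0
    (hNρ.trans (Real.rpow_le_rpow hρ.le hR.1.le (by linarith)))
  rw [lintegral_lam, ← Ioo_union_Ici_eq_Ioi hR0]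
  refine (lintegral_union_le _ _ _).trans ((add_le_add hin hout).trans ?_)
  have hT := tailConst_pos (p := p) hα0 hθ
  rw [← ENNReal.ofReal_toReal (moserConst_ne_top (p := p)), ← ENNReal.ofReal_mul (by positivity),
    ← ENNReal.ofReal_add (by positivity) (by positivity)]
  refine ENNReal.ofReal_le_ofReal ?_
  have hRθ : R ^ (θ + 1) ≤ 2 ^ (θ + 1) * (N / (1 - q)) := by
    rw [← hρθ, ← Real.mul_rpow (by norm_num) hρ.le]
    exact Real.rpow_le_rpow hR0.le hR.2.le (by linarith)
  have hNσ : N ≤ N / (1 - q) := hNρ.trans_eq hρθ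
  calc omega θ * Real.exp (muCrit α θ * (2 / omega θ) ^ (1 / (p - 1))) * R ^ (θ + 1) *
        (moserConst p).toReal + tailConst p α θ * N
      ≤ omega θ * Real.exp (muCrit α θ * (2 / omega θ) ^ (1 / (p - 1))) *
        (2 ^ (θ + 1) * (N / (1 - q))) * (moserConst p).toReal +
        tailConst p α θ * (N / (1 - q)) := by gcongr
    _ = upperConst p α θ / (1 - q) * N := by
        unfold upperConst
        ring

lemma TMSC_le {p α θ μ : ℝ} (hp : 2 ≤ p) (hα : α = p - 1) (hθ : 0 ≤ θ) (hμ0 : 0 ≤ μ)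
    (hμ : μ < muCrit α θ) :
    TMSC p α θ μ ≤ ENNReal.ofReal (upperConst p α θ / (1 - (μ / muCrit α θ) ^ (p - 1))) := by
  have hp0 : 0 < p := by linarith
  have hμs : 0 < muCrit α θ := hμ0.trans_lt hμ
  unfold TMSC
  refine iSup_le fun u => iSup_le fun hu => iSup_le fun hne => iSup_le fun hgrad => ?_
  have hN0 : eLpNorm u (ENNReal.ofReal p) (lam θ) ^ p ≠ 0 := by
    simp [ENNReal.rpow_eq_zero_iff, hu.eLpNorm_ne_zero hp0 hθ hne, hp0.not_gt]
  have hNt : eLpNorm u (ENNReal.ofReal p) (lam θ) ^ p ≠ ⊤ :=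
    ENNReal.rpow_ne_top_of_nonneg hp0.le hu.memLp.2.ne
  refine ENNReal.div_le_of_le_mul ?_
  have := lintegral_phi_le hu hp hα hθ (energy_univ_le_one hp0 hgrad) hμ0 hμ
    (ENNReal.toReal_pos hN0 hNt)
    (by rw [ENNReal.ofReal_toReal hNt, eLpNorm_rpow_eq hp0])
  have hq1 : (μ / muCrit α θ) ^ (p - 1) ≤ 1 :=
    Real.rpow_le_one (by positivity) ((div_le_one hμs).2 hμ.le) (by linarith)
  rwa [ENNReal.ofReal_mul (div_nonneg (upperConst_pos (by linarith) hθ).le (by linarith)),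
    ENNReal.ofReal_toReal hNt] at this

/-! ### The lower bound -/

/-- Moser's function: a truncated logarithm that equals `A * L` on `(0, exp (-L)]` and vanishes on
`[1, ∞)`. -/
noncomputable def moserFun (A L r : ℝ) : ℝ := A * max 0 (min L (-Real.log r))

lemma measurable_moserFun (A L : ℝ) : Measurable (moserFun A L) := by
  unfold moserFun
  fun_prop

lemma moserFun_of_one_le {A L r : ℝ} (hr : 1 ≤ r) : moserFun A L r = 0 := by
  have : min L (-Real.log r) ≤ 0 := (min_le_right _ _).trans (by linarith [Real.log_nonneg hr])
  rw [moserFun, max_eq_left this, mul_zero]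

lemma moserFun_of_le {A L r : ℝ} (hL : 0 ≤ L) (hr : 0 < r) (h : r ≤ Real.exp (-L)) :
    moserFun A L r = A * L := by
  have : L ≤ -Real.log r := by
    have := (Real.log_le_iff_le_exp hr).2 h
    linarith
  rw [moserFun, min_eq_left this, max_eq_right hL]

lemma moserFun_of_mem {A L r : ℝ} (hr : r ∈ Icc (Real.exp (-L)) 1) :
    moserFun A L r = A * -Real.log r := by
  have hr0 : 0 < r := (Real.exp_pos _).trans_le hr.1
  have h1 : -Real.log r ≤ L := by
    have := (Real.le_log_iff_exp_le hr0).2 hr.1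
    linarith
  have h2 : 0 ≤ -Real.log r := by linarith [Real.log_nonpos hr0.le hr.2]
  rw [moserFun, min_eq_right h1, max_eq_right h2]

lemma moserFun_nonneg {A L r : ℝ} (hA : 0 ≤ A) : 0 ≤ moserFun A L r :=
  mul_nonneg hA (le_max_left _ _)

lemma moserFun_le_log {A L r : ℝ} (hA : 0 ≤ A) (hr : r ∈ Ioo 0 1) :
    moserFun A L r ≤ A * -Real.log r := by
  have h2 : 0 ≤ -Real.log r := by linarith [Real.log_nonpos hr.1.le hr.2.le]
  exact mul_le_mul_of_nonneg_left (max_le h2 (min_le_right _ _)) hA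

lemma absolutelyContinuousOnInterval_moserFun {A L a b : ℝ} (ha : 0 < a) (hab : a ≤ b) :
    AbsolutelyContinuousOnInterval (moserFun A L) a b := by
  have hlog : AbsolutelyContinuousOnInterval Real.log a b := by
    refine ContDiffOn.absolutelyContinuousOnInterval ?_
    rw [uIcc_of_le hab]
    exact fun x hx => (Real.contDiffAt_log.2 (ha.trans_le hx.1).ne').contDiffWithinAt
  have hlip : LipschitzWith 1 fun t : ℝ => max 0 (min L (-t)) :=
    (LipschitzWith.id.neg.const_min L).const_max 0
  refine AbsolutelyContinuousOnInterval.const_mul A ?_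
  refine squeeze_zero (fun _ => Finset.sum_nonneg fun _ _ => dist_nonneg) (fun E => ?_) hlog
  exact Finset.sum_le_sum fun i _ => by simpa using hlip.dist_le_mul _ _

lemma enorm_deriv_moserFun_rpow_le {p A L r : ℝ} (hp : 0 < p) (hA : 0 ≤ A) (hL : 0 ≤ L)
    (hr : 0 < r) (hr1 : r ≠ 1) (hrL : r ≠ Real.exp (-L)) :
    ‖deriv (moserFun A L) r‖ₑ ^ p ≤
      (Icc (Real.exp (-L)) 1).indicator (fun r => ENNReal.ofReal ((A / r) ^ p)) r := by
  rcases lt_or_gt_of_ne hrL with h | h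
  · have : moserFun A L =ᶠ[𝓝 r] fun _ => A * L := by
      filter_upwards [Ioo_mem_nhds hr h] with x hx
      exact moserFun_of_le hL hx.1 hx.2.le
    rw [this.deriv_eq]
    simp [hp]
  rcases lt_or_gt_of_ne hr1 with h1 | h1
  · have : moserFun A L =ᶠ[𝓝 r] fun x => A * -Real.log x := by
      filter_upwards [Ioo_mem_nhds h h1] with x hx
      exact moserFun_of_mem ⟨hx.1.le, hx.2.le⟩
    have hd : HasDerivAt (fun x => A * -Real.log x) (A * -r⁻¹) r :=
      (Real.hasDerivAt_log hr.ne').neg.const_mul A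
    rw [this.deriv_eq, hd.deriv, indicator_of_mem (mem_Icc.2 ⟨h.le, h1.le⟩), ← ofReal_norm,
      ENNReal.ofReal_rpow_of_nonneg (norm_nonneg _) hp.le, mul_neg, norm_neg,
      ← div_eq_mul_inv, Real.norm_of_nonneg (by positivity)]
  · have : moserFun A L =ᶠ[𝓝 r] fun _ => 0 := by
      filter_upwards [Ioi_mem_nhds h1] with x hx
      exact moserFun_of_one_le (le_of_lt hx)
    rw [this.deriv_eq]
    simp [hp]

/-- Moser's functions are normalized by `A = (omega α * L) ^ (-(1 / p))`. -/
lemma lintegral_deriv_moserFun_le {p α L : ℝ} (hp : 2 ≤ p) (hα : α = p - 1) (hL : 0 < L) :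
    ∫⁻ r, ‖deriv (moserFun ((omega α * L) ^ (-(1 / p))) L) r‖ₑ ^ p ∂(lam α) ≤ 1 := by
  have hp0 : 0 < p := by linarith
  have hω : 0 < omega α := omega_pos (by linarith)
  set A := (omega α * L) ^ (-(1 / p)) with hA
  have hA0 : 0 < A := by positivity
  have hAp : A ^ p = (omega α * L)⁻¹ := by
    rw [hA, ← Real.rpow_mul (by positivity), neg_mul, one_div_mul_cancel hp0.ne',
      Real.rpow_neg_one]
  have hs : Icc (Real.exp (-L)) 1 ⊆ Ioi 0 := fun r hr => (Real.exp_pos _).trans_le hr.1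
  have hexp : Real.exp (-L) ≤ 1 := Real.exp_le_one_iff.2 (by linarith)
  rw [lintegral_lam, setLIntegral_lam measurableSet_Ioi Subset.rfl]
  calc ∫⁻ r in Ioi 0, ENNReal.ofReal (omega α * r ^ α) * ‖deriv (moserFun A L) r‖ₑ ^ p
      ≤ ∫⁻ r in Ioi 0, (Icc (Real.exp (-L)) 1).indicator
          (fun r => ENNReal.ofReal (omega α * A ^ p) * ENNReal.ofReal (1 / r)) r := by
        refine lintegral_mono_ae ?_
        filter_upwards [ae_restrict_mem measurableSet_Ioi,
          ae_restrict_of_ae (Measure.ae_ne volume 1),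
          ae_restrict_of_ae (Measure.ae_ne volume (Real.exp (-L)))] with r hr hr1 hrL
        have hr0 : 0 < r := hr
        refine (mul_le_mul_right
          (enorm_deriv_moserFun_rpow_le hp0 hA0.le hL.le hr0 hr1 hrL) _).trans ?_
        by_cases hmem : r ∈ Icc (Real.exp (-L)) 1
        · rw [indicator_of_mem hmem, indicator_of_mem hmem, ← ENNReal.ofReal_mul (by positivity),
            ← ENNReal.ofReal_mul (by positivity)]
          refine ENNReal.ofReal_le_ofReal (le_of_eq ?_)
          rw [Real.div_rpow hA0.le hr0.le, hα, Real.rpow_sub hr0, Real.rpow_one]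
          have := Real.rpow_pos_of_pos hr0 p
          field_simp
        · rw [indicator_of_notMem hmem, indicator_of_notMem hmem, mul_zero]
    _ = ENNReal.ofReal (omega α * A ^ p) * ENNReal.ofReal L := by
        rw [lintegral_indicator measurableSet_Icc, Measure.restrict_restrict measurableSet_Icc,
          inter_eq_left.2 hs, lintegral_const_mul _ (by fun_prop),
          setLIntegral_inv_Icc (Real.exp_pos _) hexp, one_div, ← Real.exp_neg, neg_neg,
          Real.log_exp]
    _ = 1 := by
        rw [hAp, ← ENNReal.ofReal_mul (by positivity), ← ENNReal.ofReal_one]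
        congr 1
        field_simp

/-- The `L^p_θ` norm of Moser's functions is of order `A`, uniformly in `L`, since
`(log (1 / r)) ^ p` is integrable at the origin. -/
lemma lintegral_moserFun_le {p θ A L : ℝ} (hp : 2 ≤ p) (hθ : 0 ≤ θ) (hA : 0 ≤ A) :
    ∫⁻ r, ‖moserFun A L r‖ₑ ^ p ∂(lam θ) ≤
      ENNReal.ofReal (2 * omega θ * (2 * p) ^ p * A ^ p) := by
  have hp0 : 0 < p := by linarith
  have hω : 0 < omega θ := omega_pos hθ
  have hs : Ioo (0 : ℝ) 1 ⊆ Ioi 0 := fun r hr => hr.1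
  rw [lintegral_lam, setLIntegral_lam measurableSet_Ioi Subset.rfl]
  calc ∫⁻ r in Ioi 0, ENNReal.ofReal (omega θ * r ^ θ) * ‖moserFun A L r‖ₑ ^ p
      ≤ ∫⁻ r in Ioi 0, (Ioo 0 1).indicator (fun r => ENNReal.ofReal
          (omega θ * (2 * p) ^ p * A ^ p) * ENNReal.ofReal (r ^ (-(1 / 2) : ℝ))) r := by
        refine setLIntegral_mono' measurableSet_Ioi fun r hr => ?_
        have hr0 : 0 < r := hr
        rcases lt_or_ge r 1 with h1 | h1
        · rw [indicator_of_mem (mem_Ioo.2 ⟨hr0, h1⟩), ← ofReal_norm,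
            Real.norm_of_nonneg (moserFun_nonneg hA),
            ENNReal.ofReal_rpow_of_nonneg (moserFun_nonneg hA) hp0.le,
            ← ENNReal.ofReal_mul (by positivity), ← ENNReal.ofReal_mul (by positivity)]
          refine ENNReal.ofReal_le_ofReal ?_
          have hlog : -Real.log r ≤ 2 * p * r ^ (-(1 / (2 * p))) := by
            have := Real.log_le_rpow_div (inv_nonneg.2 hr0.le) (show 0 < 1 / (2 * p) by positivity)
            rw [Real.log_inv, Real.inv_rpow hr0.le, ← Real.rpow_neg hr0.le] at this
            refine this.trans_eq ?_
            field_simp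
          have h2 : moserFun A L r ≤ A * (2 * p * r ^ (-(1 / (2 * p)))) :=
            (moserFun_le_log hA ⟨hr0, h1⟩).trans (mul_le_mul_of_nonneg_left hlog hA)
          have h3 := Real.rpow_le_rpow (moserFun_nonneg hA) h2 hp0.le
          rw [Real.mul_rpow hA (by positivity), Real.mul_rpow (by positivity) (by positivity),
            ← Real.rpow_mul hr0.le, show -(1 / (2 * p)) * p = -(1 / 2) by field_simp] at h3
          have h4 : r ^ θ ≤ 1 := Real.rpow_le_one hr0.le h1.le hθ
          calc omega θ * r ^ θ * moserFun A L r ^ p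
              ≤ omega θ * 1 * (A ^ p * ((2 * p) ^ p * r ^ (-(1 / 2) : ℝ))) := by
                have := Real.rpow_nonneg (moserFun_nonneg (L := L) (r := r) hA) p
                gcongr
            _ = _ := by ring
        · rw [moserFun_of_one_le h1, enorm_zero, ENNReal.zero_rpow_of_pos hp0, mul_zero]
          exact zero_le
    _ = ENNReal.ofReal (omega θ * (2 * p) ^ p * A ^ p) * ENNReal.ofReal 2 := by
        rw [lintegral_indicator measurableSet_Ioo, Measure.restrict_restrict measurableSet_Ioo,
          inter_eq_left.2 hs, lintegral_const_mul _ (by fun_prop)]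
        congr 1
        rw [← ofReal_integral_eq_lintegral_ofReal]
        · rw [← integral_Ioc_eq_integral_Ioo, ← intervalIntegral.integral_of_le zero_le_one,
            integral_rpow (Or.inl (by norm_num))]
          norm_num
        · exact (intervalIntegral.integrableOn_Ioo_rpow_iff one_pos).2 (by norm_num)
        · exact (ae_restrict_mem measurableSet_Ioo).mono fun r hr => Real.rpow_nonneg hr.1.le _
    _ = _ := by
        rw [← ENNReal.ofReal_mul (by positivity)]
        congr 1
        ring

lemma memX_moserFun {p α θ L : ℝ} (hp : 2 ≤ p) (hα : α = p - 1) (hθ : 0 ≤ θ) (hL : 0 < L) :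
    MemX p α θ (moserFun ((omega α * L) ^ (-(1 / p))) L) := by
  have hp0 : 0 < p := by linarith
  have hω : 0 < omega α := omega_pos (by linarith)
  have hp' : ENNReal.ofReal p ≠ 0 := by simpa using hp0
  refine ⟨fun a b ha hab => absolutelyContinuousOnInterval_moserFun ha hab, ?_, ?_, ?_⟩
  · refine tendsto_const_nhds.congr' ?_
    filter_upwards [eventually_ge_atTop 1] with r hr
    exact (moserFun_of_one_le hr).symm
  · refine ⟨(measurable_moserFun _ _).aestronglyMeasurable, ?_⟩
    rw [eLpNorm_lt_top_iff_lintegral_rpow_enorm_lt_top hp' ENNReal.ofReal_ne_top,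
      ENNReal.toReal_ofReal hp0.le]
    exact (lintegral_moserFun_le hp hθ (by positivity)).trans_lt ENNReal.ofReal_lt_top
  · refine ⟨(measurable_deriv _).aestronglyMeasurable, ?_⟩
    rw [eLpNorm_lt_top_iff_lintegral_rpow_enorm_lt_top hp' ENNReal.ofReal_ne_top,
      ENNReal.toReal_ofReal hp0.le]
    exact (lintegral_deriv_moserFun_le hp hα hL).trans_lt ENNReal.one_lt_top

lemma exists_exp_div_two_le_phi (p : ℝ) : ∃ T : ℝ, ∀ t, T ≤ t → Real.exp t / 2 ≤ phi p t := by
  have h : Tendsto (fun t : ℝ => ∑ k ∈ Finset.range ⌈p - 1⌉₊,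
      (t ^ k * Real.exp (-t)) / (k.factorial : ℝ)) atTop (𝓝 0) := by
    have := tendsto_finsetSum (Finset.range ⌈p - 1⌉₊) fun k _ =>
      (Real.tendsto_pow_mul_exp_neg_atTop_nhds_zero k).div_const (k.factorial : ℝ)
    simpa using this
  obtain ⟨T, hT⟩ := eventually_atTop.1
    (h.eventually (gt_mem_nhds (show (0 : ℝ) < 1 / 2 by norm_num)))
  refine ⟨T, fun t ht => ?_⟩
  have h1 := hT t ht
  have h2 : ∑ k ∈ Finset.range ⌈p - 1⌉₊, t ^ k / (k.factorial : ℝ)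
      = (∑ k ∈ Finset.range ⌈p - 1⌉₊, (t ^ k * Real.exp (-t)) / (k.factorial : ℝ)) *
        Real.exp t := by
    rw [Finset.sum_mul]
    refine Finset.sum_congr rfl fun k _ => ?_
    rw [Real.exp_neg]
    field_simp
  unfold phi
  rw [h2]
  nlinarith [Real.exp_pos t]

/-- The constant of the lower bound: the mass of the plateau of Moser's function over the bound for
its `L^p_θ` norm. -/
noncomputable def lowerConst (p α θ : ℝ) : ℝ :=
  omega α / (4 * (θ + 1) * (2 * p) ^ p)

lemma lowerConst_pos {p α θ : ℝ} (hp : 0 < p) (hα : 0 ≤ α) (hθ : 0 ≤ θ) :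
    0 < lowerConst p α θ := by
  have := omega_pos hα
  unfold lowerConst
  positivity

/-- The lower bound given by Moser's function of height parameter `L`, read off on the interval
`(0, exp (-L))`, where it is constant. -/
lemma le_TMSC {p α θ : ℝ} (hp : 2 ≤ p) (hα : α = p - 1) (hθ : 0 ≤ θ) :
    ∃ L₀ : ℝ, 0 < L₀ ∧ ∀ L μ : ℝ, L₀ ≤ L → 1 / 2 ≤ μ / muCrit α θ →
      ENNReal.ofReal (lowerConst p α θ * L * Real.exp (-(θ + 1) * (1 - μ / muCrit α θ) * L))
        ≤ TMSC p α θ μ := by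
  obtain ⟨T, hT⟩ := exists_exp_div_two_le_phi p
  refine ⟨max 1 (2 * T), by positivity, fun L μ hL hμ => ?_⟩
  have hp0 : 0 < p := by linarith
  have hp1 : 0 < p - 1 := by linarith
  have hα0 : 0 ≤ α := by linarith
  have hωα : 0 < omega α := omega_pos hα0
  have hωθ : 0 < omega θ := omega_pos hθ
  have hμs : 0 < muCrit α θ := muCrit_pos hα0 hθ
  have hL1 : 1 ≤ L := (le_max_left _ _).trans hL
  have hLT : 2 * T ≤ L := (le_max_right _ _).trans hL
  have hL0 : 0 < L := by linarith
  have hc := lowerConst_pos hp0 hα0 hθ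
  set A := (omega α * L) ^ (-(1 / p)) with hA
  have hA0 : 0 < A := by positivity
  have hAp : A ^ p = (omega α * L)⁻¹ := by
    rw [hA, ← Real.rpow_mul (by positivity), neg_mul, one_div_mul_cancel hp0.ne',
      Real.rpow_neg_one]
  have hX : MemX p α θ (moserFun A L) := memX_moserFun hp hα hθ hL0
  have hplateau : ∀ r ∈ Ioo 0 (Real.exp (-L)), moserFun A L r = A * L := fun r hr =>
    moserFun_of_le hL0.le hr.1 hr.2.le
  have hne : ∃ r : ℝ, 0 < r ∧ moserFun A L r ≠ 0 := by
    refine ⟨Real.exp (-L), Real.exp_pos _, ?_⟩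
    rw [moserFun_of_le hL0.le (Real.exp_pos _) le_rfl]
    positivity
  have hgrad : eLpNorm (deriv (moserFun A L)) (ENNReal.ofReal p) (lam α) ≤ 1 := by
    have := lintegral_deriv_moserFun_le hp hα hL0
    rw [← eLpNorm_rpow_eq hp0, ← ENNReal.one_rpow p] at this
    exact (ENNReal.rpow_le_rpow_iff hp0).1 this
  -- On the plateau the exponent equals `(θ + 1) * (μ / μ_{α,θ}) * L`.
  have hexpo : μ * |A * L| ^ (p / (p - 1)) = (θ + 1) * (μ / muCrit α θ) * L := by
    have h1 : |A * L| ^ (p / (p - 1)) = L / omega α ^ (1 / α) := by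
      rw [abs_of_pos (by positivity), Real.mul_rpow hA0.le hL0.le, hA,
        ← Real.rpow_mul (by positivity),
        show -(1 / p) * (p / (p - 1)) = -(1 / (p - 1)) by field_simp,
        Real.rpow_neg (by positivity), Real.mul_rpow hωα.le hL0.le,
        show p / (p - 1) = 1 + 1 / (p - 1) by field_simp; ring, Real.rpow_add hL0, Real.rpow_one,
        hα]
      have := Real.rpow_pos_of_pos hL0 (1 / (p - 1))
      field_simp
    rw [h1, muCrit]
    field_simp
  set e := (θ + 1) * (μ / muCrit α θ) * L with he
  have hphi : Real.exp e / 2 ≤ phi p e := by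
    refine hT e ?_
    have : 1 / 2 ≤ (θ + 1) * (μ / muCrit α θ) := by nlinarith
    nlinarith
  have hnum : ENNReal.ofReal (Real.exp e / 2 * (omega θ * Real.exp (-(θ + 1) * L) / (θ + 1))) ≤
      ∫⁻ r, ENNReal.ofReal (phi p (μ * |moserFun A L r| ^ (p / (p - 1)))) ∂(lam θ) := by
    have hs : Ioo 0 (Real.exp (-L)) ⊆ Ioi 0 := fun r hr => hr.1
    refine le_trans ?_ (setLIntegral_le_lintegral (Ioo 0 (Real.exp (-L))) _)
    calc ENNReal.ofReal (Real.exp e / 2 * (omega θ * Real.exp (-(θ + 1) * L) / (θ + 1)))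
        = ENNReal.ofReal (Real.exp e / 2 * omega θ) *
            ∫⁻ r in Ioo 0 (Real.exp (-L)), ENNReal.ofReal (r ^ θ) := by
          rw [← ofReal_integral_eq_lintegral_ofReal, ← integral_Ioc_eq_integral_Ioo,
            ← intervalIntegral.integral_of_le (Real.exp_pos _).le,
            integral_rpow (Or.inl (by linarith)), ← ENNReal.ofReal_mul (by positivity),
            Real.zero_rpow (by linarith), ← Real.exp_mul]
          · congr 1
            rw [show -(θ + 1) * L = -L * (θ + 1) by ring]
            ring
          · exact (intervalIntegral.integrableOn_Ioo_rpow_iff (Real.exp_pos _)).2 (by linarith)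
          · exact (ae_restrict_mem measurableSet_Ioo).mono fun r hr => Real.rpow_nonneg hr.1.le _
      _ = ∫⁻ r in Ioo 0 (Real.exp (-L)),
            ENNReal.ofReal (Real.exp e / 2 * omega θ) * ENNReal.ofReal (r ^ θ) :=
          (lintegral_const_mul _ (by fun_prop)).symm
      _ ≤ ∫⁻ r in Ioo 0 (Real.exp (-L)), ENNReal.ofReal (omega θ * r ^ θ) *
            ENNReal.ofReal (phi p (μ * |moserFun A L r| ^ (p / (p - 1)))) := by
          refine setLIntegral_mono' measurableSet_Ioo fun r hr => ?_
          have hrθ := Real.rpow_nonneg hr.1.le θ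
          rw [hplateau r hr, hexpo, ← ENNReal.ofReal_mul (by positivity),
            ← ENNReal.ofReal_mul (by positivity)]
          refine ENNReal.ofReal_le_ofReal ?_
          have := mul_le_mul_of_nonneg_left hphi (show 0 ≤ omega θ * r ^ θ by positivity)
          linarith
      _ = _ := (setLIntegral_lam measurableSet_Ioo hs _).symm
  have hden := lintegral_moserFun_le (L := L) hp hθ hA0.le
  rw [hAp, ← eLpNorm_rpow_eq hp0] at hden
  unfold TMSC
  refine le_iSup_of_le (moserFun A L) (le_iSup_of_le hX (le_iSup_of_le hne
    (le_iSup_of_le hgrad ?_)))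
  have hN0 : eLpNorm (moserFun A L) (ENNReal.ofReal p) (lam θ) ^ p ≠ 0 := by
    simp [ENNReal.rpow_eq_zero_iff, hX.eLpNorm_ne_zero hp0 hθ hne, hp0.not_gt]
  rw [ENNReal.le_div_iff_mul_le (Or.inl hN0)
    (Or.inl (hden.trans_lt ENNReal.ofReal_lt_top).ne)]
  refine (mul_le_mul_right hden _).trans (le_trans (le_of_eq ?_) hnum)
  rw [← ENNReal.ofReal_mul (by positivity)]
  congr 1
  have : Real.exp (-(θ + 1) * (1 - μ / muCrit α θ) * L)
      = Real.exp e * Real.exp (-(θ + 1) * L) := by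
    rw [← Real.exp_add, he]
    ring_nf
  rw [this, lowerConst]
  have := Real.rpow_pos_of_pos (show 0 < 2 * p by positivity) p
  field_simp
  ring

end TrudingerMoser

/-- Sharp asymptotics of the subcritical Trudinger-Moser supremum on weighted Sobolev spaces. -/
theorem theorem1p1 (p α θ : ℝ) (hp : 2 ≤ p) (hα : α = p - 1) (hθ : 0 ≤ θ) :
    (∃ c C : ℝ, 0 < c ∧ 0 < C ∧
      (∀ᶠ μ in 𝓝[<] (TrudingerMoser.muCrit α θ),
        ENNReal.ofReal (c / (1 - (μ / TrudingerMoser.muCrit α θ) ^ (p - 1)))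
            ≤ TrudingerMoser.TMSC p α θ μ ∧
        TrudingerMoser.TMSC p α θ μ
            ≤ ENNReal.ofReal (C / (1 - (μ / TrudingerMoser.muCrit α θ) ^ (p - 1)))) ∧
      (∀ μ : ℝ, 0 ≤ μ → μ < TrudingerMoser.muCrit α θ →
        TrudingerMoser.TMSC p α θ μ
            ≤ ENNReal.ofReal (C / (1 - (μ / TrudingerMoser.muCrit α θ) ^ (p - 1))))) ∧
    TrudingerMoser.TMSC p α θ (TrudingerMoser.muCrit α θ) = ⊤ := by
  have hα0 : 0 ≤ α := by linarith
  have hμs := TrudingerMoser.muCrit_pos hα0 hθ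
  have hc := TrudingerMoser.lowerConst_pos (p := p) (by linarith) hα0 hθ
  have hup := fun μ (h0 : 0 ≤ μ) h => TrudingerMoser.TMSC_le (p := p) (μ := μ) hp hα hθ h0 h
  obtain ⟨L₀, hL₀, hlow⟩ := TrudingerMoser.le_TMSC hp hα hθ
  set m := TrudingerMoser.muCrit α θ with hm
  refine ⟨⟨TrudingerMoser.lowerConst p α θ * Real.exp (-(θ + 1)),
    TrudingerMoser.upperConst p α θ, by positivity, TrudingerMoser.upperConst_pos hα0 hθ,
    ?_, hup⟩, ?_⟩
  · have h1 : ∀ᶠ μ in 𝓝[<] m, max (1 / 2) (1 - 1 / L₀) * m < μ := by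
      refine eventually_nhdsWithin_of_eventually_nhds (lt_mem_nhds ?_)
      refine mul_lt_of_lt_one_left hμs (max_lt (by norm_num) ?_)
      linarith [one_div_pos.2 hL₀]
    filter_upwards [h1, self_mem_nhdsWithin] with μ hμ1 hμ2
    have hμlt : μ < m := hμ2
    rw [← lt_div_iff₀ hμs] at hμ1
    have hs1 : 1 / 2 < μ / m := (le_max_left _ _).trans_lt hμ1
    have hs2 : 1 - 1 / L₀ < μ / m := (le_max_right _ _).trans_lt hμ1
    have hs3 : μ / m < 1 := (div_lt_one hμs).2 hμlt
    have hμ0 : 0 ≤ μ := by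
      by_contra! h
      linarith [div_neg_of_neg_of_pos h hμs]
    refine ⟨?_, hup μ hμ0 hμlt⟩
    -- The optimal height parameter is the inverse of `1 - μ / μ_{α,θ}`.
    have hε : 0 < 1 - μ / m := by linarith
    have hL : L₀ ≤ 1 / (1 - μ / m) := by
      rw [le_one_div hL₀ hε]
      linarith
    refine le_trans (ENNReal.ofReal_le_ofReal ?_) (hlow (1 / (1 - μ / m)) μ hL hs1.le)
    have hpow : (μ / m) ^ (p - 1) ≤ μ / m := by
      have := Real.rpow_le_rpow_of_exponent_ge (by linarith) hs3.le (show 1 ≤ p - 1 by linarith)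
      rwa [Real.rpow_one] at this
    rw [mul_assoc (-(θ + 1)), mul_one_div_cancel hε.ne', mul_one, mul_one_div,
      div_mul_eq_mul_div]
    exact div_le_div_of_nonneg_left (by positivity) hε (by linarith)
  · refine ENNReal.eq_top_of_forall_nnreal_le fun x => ?_
    have h := hlow (max L₀ (x / TrudingerMoser.lowerConst p α θ)) m (le_max_left _ _)
      (by rw [div_self hμs.ne']; norm_num)
    rw [div_self hμs.ne', sub_self, mul_zero, zero_mul, Real.exp_zero, mul_one] at h
    refine le_trans ?_ h
    rw [← ENNReal.ofReal_coe_nnreal]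
    refine ENNReal.ofReal_le_ofReal ?_
    rw [← div_le_iff₀' hc]
    exact le_max_right _ _
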